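/- Conventions. All matrix norms are operator norms, $n\ge 2$, and Hessenberg means upper Hessenberg. Computations are done in floating point arithmetic with unit roundoff $\mathbf u\ge 0$: every operation $+,-,\times,\div$ on complex numbers, and the square root of a positive number, is computed with relative error at most $\mathbf u$ (no overflow or underflow). A degree one implicit QR algorithm $\mathsf{IQR}$ is given, i.e. an arithmetic program that maps a Hessenberg matrix $A\in\mathbb C^{n\times n}$ and a shift $z\in\mathbb C$ to a Hessenberg matrix $\mathsf{IQR}(A,z)$ and an upper triangular matrix $R$. It is $\nu$-stable with $\nu=\nu_{\mathsf{IQR}}(n)>0$: for all such $A,z$ there is a unitary $Q$ with $$\|\mathsf{IQR}(A,z)-Q^*AQ\|\le(\|A\|+|z|)\,\nu\,\mathbf u,\qquad \|A-z-QR\|\le(\|A\|+|z|)\,\nu\,\mathbf u .$$ One call uses at most $7n^2$ arithmetic operations; put $T_{\mathsf{IQR}}(n,m):=7mn^2$. On input a Hessenberg matrix $H\in\mathbb C^{n\times n}$, $\lambda'\in\mathbb C$ and $\omega>0$, the algorithm $\mathsf{Decouple}$ sets $\hat H\leftarrow H$, repeats $\hat H\leftarrow\mathsf{IQR}(\hat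 H,\lambda')$ while $|\hat H_{n,n-1}|>\omega$, and then outputs $\hat H$. For a diagonalizable $H$ let $\kappa_V(H)$ be the infimum (a minimum) of $\|V\|\|V^{-1}\|$ over all $V$ with $V^{-1}HV$ diagonal. Fix any diagonalization $H=V\,\mathrm{diag}(\lambda_1,\dots,\lambda_n)V^{-1}$ with $\|V\|=\|V^{-1}\|=\sqrt{\kappa_V(H)}$, and let $Z_H$ be the random variable with $\mathbb P[Z_H=\lambda_i]=|e_n^*Ve_i|^2/\|e_n^*V\|^2$ (probabilities of repeated eigenvalues being added up). Proposition. There is a universal constant $C>0$ such that the following holds for all data as above. Let $H$ be Hessenberg and diagonalizable, let $d:=\mathrm{dist}(\lambda',\mathrm{Spec}\,H)$ satisfy $0<d\le\omega/2$, and let $p:=\mathbb P[|Z_H-\lambda'|=d]$ be positive. Put $$m:=\left\lceil\frac{\log(\kappa_V(H)^2/p)}{2\log(3\omega/4d)}\right\rceil$$ (here $3\omega/4d$ means $3\omega/(4d)$) and assume $$\mathbf u\le\frac{1}{8\,\kappa_V(H)\,\nu}\left(\frac{d}{\|H\|}\right)^{m}\frac{\omega}{16\cdot5^m\,n^{1/2}\,\|H\|}.$$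 Then $\mathsf{Decouple}(H,\lambda',\omega)$ halts after at most $m$ calls to $\mathsf{IQR}$. Its output $\hat H$ is Hessenberg, $|\hat H_{n,n-1}|\le\omega$, and there is a unitary $Q$ with $\|\hat H-Q^*HQ\|\le3.5\,m\,\|H\|\,\nu\,\mathbf u$. The calls to $\mathsf{IQR}$ use at most $m\,T_{\mathsf{IQR}}(n,m)$ arithmetic operations in total; when each of the evaluations of the loop condition is counted as one further operation, the total is at most $m\,T_{\mathsf{IQR}}(n,m)+m+1$. Both this total and $m\,T_{\mathsf{IQR}}(n,m)$ are at most $C\,(1+\log(\kappa_V(H)/p))^2\,n^2$, and at most $C\log^2(\kappa_V(H)/p)\,n^2$ whenever $\kappa_V(H)/p\ge2$. -/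

import Mathlib

open scoped Matrix Matrix.Norms.L2Operator

/-! ### Floating point arithmetic and arithmetic programs

Matrix norms below are the `ℓ²` operator norm. -/

/-- The binary arithmetic operations. -/
inductive ArithOp where
  | add
  | sub
  | mul
  | div

/-- The exact value of a binary operation. -/
noncomputable def ArithOp.exact : ArithOp → ℂ → ℂ → ℂ
  | .add, x, y => x + y
  | .sub, x, y => x - y
  | .mul, x, y => x * y
  | .div, x, y => x / y

/-- Floating point arithmetic with unit roundoff `u`, without overflow and underflow: every
operation, and the square root of a positive number, is computed with relative error at most `u`.
Nothing is assumed about division by zero. -/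
structure FloatArith (u : ℝ) where
  op : ArithOp → ℂ → ℂ → ℂ
  sqrt : ℝ → ℝ
  op_err : ∀ (o : ArithOp) (x y : ℂ), (o = ArithOp.div → y ≠ 0) →
    ‖op o x y - o.exact x y‖ ≤ u * ‖o.exact x y‖
  sqrt_err : ∀ x : ℝ, 0 < x → |sqrt x - Real.sqrt x| ≤ u * Real.sqrt x

/-- Arithmetic programs (algebraic computation trees). The registers currently available are
indexed by the type argument `ι`; each instruction that produces a number adds one register
(`none : Option ι`); the output numbers are indexed by `β`. -/
inductive ArithProg (β : Type) : Type → Type 1 where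
  /-- stop, and output for each `b : β` the content of the register `out b` -/
  | ret {ι : Type} (out : β → ι) : ArithProg β ι
  /-- store a constant -/
  | const {ι : Type} (c : ℂ) (rest : ArithProg β (Option ι)) : ArithProg β ι
  /-- store the complex conjugate of a register -/
  | conj {ι : Type} (i : ι) (rest : ArithProg β (Option ι)) : ArithProg β ι
  /-- store the result of a floating point operation -/
  | arith {ι : Type} (o : ArithOp) (i j : ι) (rest : ArithProg β (Option ι)) : ArithProg β ι
  /-- store the floating point square root of (the real part of) a register -/
  | sqrt {ι : Type} (i : ι) (rest : ArithProg β (Option ι)) : ArithProg β ι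
  /-- branch on the comparison of (the real parts of) two registers -/
  | test {ι : Type} (i j : ι) (ifLt ifGe : ArithProg β ι) : ArithProg β ι

open Classical in
/-- Run a program on given register contents in the floating point arithmetic `F`: the output,
and the number of arithmetic operations (`+`, `-`, `*`, `/`, square roots) that were performed. -/
noncomputable def ArithProg.run {u : ℝ} (F : FloatArith u) {β : Type} :
    {ι : Type} → ArithProg β ι → (ι → ℂ) → (β → ℂ) × ℕ
  | _, .ret out, x => (fun b => x (out b), 0)
  | _, .const c rest, x => rest.run F (fun a => a.elim c x)
  | _, .conj i rest, x => rest.run F (fun a => a.elim ((starRingEnd ℂ) (x i)) x)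
  | _, .arith o i j rest, x =>
      let r := rest.run F (fun a => a.elim (F.op o (x i) (x j)) x)
      (r.1, r.2 + 1)
  | _, .sqrt i rest, x =>
      let r := rest.run F (fun a => a.elim ((F.sqrt (x i).re : ℝ) : ℂ) x)
      (r.1, r.2 + 1)
  | _, .test i j ifLt ifGe, x =>
      if (x i).re < (x j).re then ifLt.run F x else ifGe.run F x

/-! ### Implicit QR steps -/

/-- Upper Hessenberg matrices. -/
def IsHessenberg {n : ℕ} (H : Matrix (Fin n) (Fin n) ℂ) : Prop :=
  ∀ i j : Fin n, (j : ℕ) + 1 < (i : ℕ) → H i j = 0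

/-- The entry in the last row and the last but one column. -/
def lastSubdiag {n : ℕ} (hn : 2 ≤ n) (H : Matrix (Fin n) (Fin n) ℂ) : ℂ :=
  H ⟨n - 1, by omega⟩ ⟨n - 2, by omega⟩

/-- Programs that take an `n × n` matrix and a shift, and output two `n × n` matrices: the next
iterate and the triangular factor. -/
abbrev IQRProgram (n : ℕ) : Type 1 :=
  ArithProg ((Fin n × Fin n) ⊕ (Fin n × Fin n)) ((Fin n × Fin n) ⊕ Unit)

namespace IQRProgram

variable {u : ℝ} {n : ℕ}

/-- The input registers: the entries of `H`, and the shift `s`. -/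
def input (H : Matrix (Fin n) (Fin n) ℂ) (s : ℂ) : (Fin n × Fin n) ⊕ Unit → ℂ :=
  Sum.elim (fun ij => H ij.1 ij.2) (fun _ => s)

/-- The matrix `IQR(H, z - s)` computed by the program. -/
noncomputable def next (P : IQRProgram n) (F : FloatArith u) (H : Matrix (Fin n) (Fin n) ℂ)
    (s : ℂ) : Matrix (Fin n) (Fin n) ℂ :=
  Matrix.of fun i j => (ArithProg.run F P (input H s)).1 (Sum.inl (i, j))

/-- The triangular factor computed by the program. -/
noncomputable def factor (P : IQRProgram n) (F : FloatArith u) (H : Matrix (Fin n) (Fin n) ℂ)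
    (s : ℂ) : Matrix (Fin n) (Fin n) ℂ :=
  Matrix.of fun i j => (ArithProg.run F P (input H s)).1 (Sum.inr (i, j))

/-- The number of arithmetic operations performed on the input `(H, s)`. -/
noncomputable def cost (P : IQRProgram n) (F : FloatArith u) (H : Matrix (Fin n) (Fin n) ℂ)
    (s : ℂ) : ℕ :=
  (ArithProg.run F P (input H s)).2

/-- `ν`-stable (backward stable) degree one implicit QR algorithms, in arithmetic with unit
roundoff `u`: the outputs are exactly Hessenberg and exactly upper triangular, and there is one
unitary matrix for which both are correct up to an error `(‖H‖ + |s|) ν u`. In particular this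
covers every algorithm whose errors are at most `‖H - s‖ ν u`. -/
def IsStable (P : IQRProgram n) (F : FloatArith u) (ν : ℝ) : Prop :=
  ∀ (H : Matrix (Fin n) (Fin n) ℂ) (s : ℂ), IsHessenberg H →
    IsHessenberg (P.next F H s) ∧
    (P.factor F H s).BlockTriangular id ∧
    ∃ Q ∈ Matrix.unitaryGroup (Fin n) ℂ,
      ‖P.next F H s - Qᴴ * H * Q‖ ≤ (‖H‖ + ‖s‖) * ν * u ∧
      ‖H - s • (1 : Matrix (Fin n) (Fin n) ℂ) - Q * P.factor F H s‖ ≤ (‖H‖ + ‖s‖) * ν * u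

end IQRProgram

/-- `T_IQR(n, m)`: the number of operations allowed for `m` implicit QR steps. -/
def opsIQR (n m : ℕ) : ℕ := 7 * m * n ^ 2

/-! ### The subroutine `Decouple` -/

/-- The value of the program variable of `Decouple` after `k` passes through the loop body. -/
noncomputable def decoupleIter {u : ℝ} {n : ℕ} (F : FloatArith u) (P : IQRProgram n)
    (H : Matrix (Fin n) (Fin n) ℂ) (s : ℂ) : ℕ → Matrix (Fin n) (Fin n) ℂ
  | 0 => H
  | k + 1 => P.next F (decoupleIter F P H s k) s

/-- The loop `while |Ĥ_{n,n-1}| > ω do Ĥ ← IQR(Ĥ, z - s)`, started at `Ĥ = H`, halts after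
exactly `k` passes; the output is then `decoupleIter F P H s k`. -/
def DecoupleHaltsAfter {u : ℝ} {n : ℕ} (hn : 2 ≤ n) (F : FloatArith u) (P : IQRProgram n)
    (H : Matrix (Fin n) (Fin n) ℂ) (s : ℂ) (ω : ℝ) (k : ℕ) : Prop :=
  (∀ j < k, ω < ‖lastSubdiag hn (decoupleIter F P H s j)‖) ∧
    ‖lastSubdiag hn (decoupleIter F P H s k)‖ ≤ ω

/-- The arithmetic operations performed inside the first `k` calls to the implicit QR program. -/
noncomputable def decoupleIQROps {u : ℝ} {n : ℕ} (F : FloatArith u) (P : IQRProgram n)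
    (H : Matrix (Fin n) (Fin n) ℂ) (s : ℂ) (k : ℕ) : ℕ :=
  ∑ j ∈ Finset.range k, P.cost F (decoupleIter F P H s j) s

/-- All operations of a run with `k` passes: those of the `k` calls, and one operation for each of
the `k + 1` evaluations of the loop condition. -/
noncomputable def decoupleOps {u : ℝ} {n : ℕ} (F : FloatArith u) (P : IQRProgram n)
    (H : Matrix (Fin n) (Fin n) ℂ) (s : ℂ) (k : ℕ) : ℕ :=
  decoupleIQROps F P H s k + (k + 1)

/-! ### Spectral quantities -/

/-- `H = V diag(λ) V⁻¹` with `V` invertible. -/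
def IsDiagonalization {n : ℕ} (H V : Matrix (Fin n) (Fin n) ℂ) (lam : Fin n → ℂ) : Prop :=
  IsUnit V ∧ H = V * Matrix.diagonal lam * V⁻¹

/-- The eigenvector condition number `κ_V(H)`. -/
noncomputable def kappaV {n : ℕ} (H : Matrix (Fin n) (Fin n) ℂ) : ℝ :=
  sInf {c : ℝ | ∃ (V : Matrix (Fin n) (Fin n) ℂ) (lam : Fin n → ℂ),
    IsDiagonalization H V lam ∧ c = ‖V‖ * ‖V⁻¹‖}

/-- A diagonalization with `‖V‖ = ‖V⁻¹‖ = √κ_V(H)`. -/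
def IsBalancedDiagonalization {n : ℕ} (H V : Matrix (Fin n) (Fin n) ℂ) (lam : Fin n → ℂ) : Prop :=
  IsDiagonalization H V lam ∧ ‖V‖ = Real.sqrt (kappaV H) ∧ ‖V⁻¹‖ = Real.sqrt (kappaV H)

open Classical in
/-- The probability that `Z_H` satisfies `E`, where the random variable `Z_H` takes the value `λ_i`
with probability `|e_n^* V e_i|² / ‖e_n^* V‖²`. -/
noncomputable def spectralProb {n : ℕ} (hn : 2 ≤ n) (V : Matrix (Fin n) (Fin n) ℂ)
    (lam : Fin n → ℂ) (E : ℂ → Prop) : ℝ :=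
  ∑ i with E (lam i),
    ‖V ⟨n - 1, by omega⟩ i‖ ^ 2 / ∑ j, ‖V ⟨n - 1, by omega⟩ j‖ ^ 2

/-- The distance of `s` to the spectrum of `H`. -/
noncomputable def distSpec {n : ℕ} (s : ℂ) (H : Matrix (Fin n) (Fin n) ℂ) : ℝ :=
  Metric.infDist s (spectrum ℂ H)

/-- `u_IQR(n, m, ‖H‖, κ_V(H), d)`, for a stability parameter `ν = ν_IQR(n)`. -/
noncomputable def roundoffIQR (ν : ℝ) (m : ℕ) (normH κ d : ℝ) : ℝ :=
  1 / (8 * κ * ν) * (d / normH) ^ m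

/-- The number `m = ⌈log(κ²/p) / (2 log(3ω/4d))⌉`. -/
noncomputable def decoupleSteps (κ p d ω : ℝ) : ℕ :=
  ⌈Real.log (κ ^ 2 / p) / (2 * Real.log (3 * ω / (4 * d)))⌉₊

/-- `u_Decouple(n, ‖H‖, κ_V(H), p, d)`. -/
noncomputable def roundoffDecouple (n : ℕ) (ν normH κ p d ω : ℝ) : ℝ :=
  roundoffIQR ν (decoupleSteps κ p d ω) normH κ d * ω /
    (16 * 5 ^ decoupleSteps κ p d ω * Real.sqrt n * normH)

/-!
Write `ℓ` for the last index, `e` for the row vector `e_ℓ^*`, `B = H - s`, and `A k` for the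
iterates, so that `A k - s ≈ Q k * R k` and `A (k + 1) ≈ (Q k)ᴴ * A k * Q k`, with errors of size
`ε`. The proof is a floating point version of the analysis of inverse iteration.

*One step.* The last row of `A (k + 1) - s ≈ R k * Q k` is `R k ℓ ℓ` times a unit vector, because
`R k` is triangular (`norm_entry_le_of_perturbed_step`). If the loop did not halt after one of the
steps `1, …, m`, then all the `|R k ℓ ℓ|` would be at least `ω - 2 ε ≥ 15 ω / 16`.

*All steps.* Let `U k = Q 0 ⋯ Q (k - 1)` and `T k = R (k - 1) ⋯ R 0`. Then `U m * T m` is a product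
of `m` matrices `U (k + 1) * R k * (U k)ᴴ`, each within `3.5 m ‖H‖ ν u` of `B`, by backward
stability of the iteration (`norm_accumUnitary_conj_sub_le`); hence `U m * T m ≈ B ^ m`
(`norm_sub_pow_le`). As `e * T m = r • e` with `r = ∏ R k ℓ ℓ`, it follows that
`|r| ‖e B^(-m)‖ ≤ 1 + ‖U m * T m - B ^ m‖ ‖B^(-m)‖` (`norm_mul_norm_row_inv_le`), and the
assumption on `u` makes the right side at most `9 / 8` (`perturbation_ratio_le`).

*Spectral weight.* The component of `e` along the eigenvectors nearest to `s` gives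
`‖e B^(-m)‖ ≥ √p / (κ d ^ m)` (`sqrt_spectralProb_le`), and `m` is chosen such that
`κ d ^ m / √p ≤ (3 ω / 4) ^ m` (`kappa_mul_pow_le`). Together `(15 / 16) ^ m ≤ 9 / 8 * (3 / 4) ^ m`,
which is false for `m ≥ 1` (`false_of_product_bounds`).

Two cases are separate. If `ω ≥ ‖H‖`, the loop halts at once. If `m = 0`, then `κ = p = 1`, all the
weight of `e` sits on the nearest eigenvectors, and `‖e B‖ ≤ d ≤ ω`
(`norm_row_sub_le_of_spectralProb_eq_one`). The cost bounds follow from `m ≤ 3 log (κ / p) + 1`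
(`decoupleSteps_le`).
-/

/-! ### Rows of a matrix and the operator norm -/

/-- The row vector `e_ℓ^*`, as a `1 × n` matrix, so that its products with matrices and their
Euclidean norms are matrix products and `ℓ²` operator norms. -/
def basisRow {n : ℕ} (ℓ : Fin n) : Matrix Unit (Fin n) ℂ :=
  Matrix.of fun _ => Pi.single ℓ 1

section Rows

variable {n : ℕ} {ℓ : Fin n}

lemma basisRow_mul_apply (M : Matrix (Fin n) (Fin n) ℂ) (i : Unit) (j : Fin n) :
    (basisRow ℓ * M) i j = M ℓ j := by
  simp [basisRow, Matrix.mul_apply, Pi.single_apply]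

lemma norm_row_sq (A : Matrix Unit (Fin n) ℂ) : ‖A‖ ^ 2 = ∑ j, ‖A () j‖ ^ 2 := by
  have h1 : A * Aᴴ = Matrix.diagonal fun _ => ((∑ j, ‖A () j‖ ^ 2 : ℝ) : ℂ) := by
    ext i k
    simp [Matrix.mul_apply, Complex.mul_conj']
  have h2 := Matrix.l2_opNorm_conjTranspose_mul_self Aᴴ
  have h3 : 0 ≤ ∑ j, ‖A () j‖ ^ 2 := by positivity
  rw [Matrix.conjTranspose_conjTranspose, Matrix.l2_opNorm_conjTranspose, h1,
    Matrix.l2_opNorm_diagonal, pi_norm_const, Complex.norm_real, Real.norm_of_nonneg h3] at h2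
  rw [sq, ← h2]

lemma norm_basisRow : ‖basisRow ℓ‖ = 1 := by
  have h : ‖basisRow ℓ‖ ^ 2 = 1 := by
    rw [norm_row_sq, Finset.sum_eq_single ℓ] <;> simp +contextual [basisRow]
  nlinarith [norm_nonneg (basisRow ℓ)]

lemma norm_entry_le_norm_row (A : Matrix Unit (Fin n) ℂ) (j : Fin n) : ‖A () j‖ ≤ ‖A‖ := by
  refine (sq_le_sq₀ (norm_nonneg _) (norm_nonneg _)).1 ?_
  rw [norm_row_sq]
  exact Finset.single_le_sum (f := fun j => ‖A () j‖ ^ 2) (fun _ _ => by positivity)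
    (Finset.mem_univ j)

lemma norm_basisRow_mul_le (M : Matrix (Fin n) (Fin n) ℂ) : ‖basisRow ℓ * M‖ ≤ ‖M‖ := by
  simpa [norm_basisRow] using Matrix.l2_opNorm_mul (basisRow ℓ) M

lemma basisRow_mul_of_blockTriangular (hℓ : ∀ j, j ≤ ℓ) {R : Matrix (Fin n) (Fin n) ℂ}
    (hR : R.BlockTriangular id) : basisRow ℓ * R = R ℓ ℓ • basisRow ℓ := by
  ext i j
  rw [basisRow_mul_apply, Matrix.smul_apply]
  rcases (hℓ j).eq_or_lt with rfl | h
  · simp [basisRow]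
  · simp [basisRow, h.ne, hR h]

end Rows

/-! ### Perturbed QR iterations -/

section Iteration

variable {n : ℕ}

/-- The accumulated unitary factor `Q 0 * Q 1 * ⋯ * Q (k - 1)`. -/
def accumUnitary (Q : ℕ → Matrix (Fin n) (Fin n) ℂ) : ℕ → Matrix (Fin n) (Fin n) ℂ
  | 0 => 1
  | k + 1 => accumUnitary Q k * Q k

/-- The accumulated triangular factor `R (k - 1) * ⋯ * R 1 * R 0`. -/
def accumTriangular (R : ℕ → Matrix (Fin n) (Fin n) ℂ) : ℕ → Matrix (Fin n) (Fin n) ℂ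
  | 0 => 1
  | k + 1 => R k * accumTriangular R k

variable {A Q R : ℕ → Matrix (Fin n) (Fin n) ℂ} {ℓ : Fin n}

lemma accumUnitary_mem (hQ : ∀ k, Q k ∈ Matrix.unitaryGroup (Fin n) ℂ) (k : ℕ) :
    accumUnitary Q k ∈ Matrix.unitaryGroup (Fin n) ℂ := by
  induction k with
  | zero => exact one_mem _
  | succ k ih => exact mul_mem ih (hQ k)

lemma basisRow_mul_accumTriangular (hℓ : ∀ j, j ≤ ℓ) (hR : ∀ k, (R k).BlockTriangular id)
    (k : ℕ) :
    basisRow ℓ * accumTriangular R k = (∏ j ∈ Finset.range k, R j ℓ ℓ) • basisRow ℓ := by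
  induction k with
  | zero => simp [accumTriangular]
  | succ k ih =>
    rw [accumTriangular, ← Matrix.mul_assoc, basisRow_mul_of_blockTriangular hℓ (hR k),
      Matrix.smul_mul, ih, smul_smul, Finset.prod_range_succ, mul_comm]

lemma norm_conj_unitary {U : Matrix (Fin n) (Fin n) ℂ} (hU : U ∈ Matrix.unitaryGroup (Fin n) ℂ)
    (M : Matrix (Fin n) (Fin n) ℂ) : ‖U * M * Uᴴ‖ = ‖M‖ := by
  have hU' : Uᴴ ∈ unitary (Matrix (Fin n) (Fin n) ℂ) := Unitary.star_mem hU
  rw [CStarRing.norm_mul_mem_unitary _ hU', CStarRing.norm_mem_unitary_mul _ hU]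

lemma norm_conj_unitary' {U : Matrix (Fin n) (Fin n) ℂ} (hU : U ∈ Matrix.unitaryGroup (Fin n) ℂ)
    (M : Matrix (Fin n) (Fin n) ℂ) : ‖Uᴴ * M * U‖ = ‖M‖ := by
  have hU' : Uᴴ ∈ unitary (Matrix (Fin n) (Fin n) ℂ) := Unitary.star_mem hU
  rw [CStarRing.norm_mul_mem_unitary _ hU, CStarRing.norm_mem_unitary_mul _ hU']

/-- Backward stability of the whole run: the `k`-th iterate, transported back by the accumulated
unitary factor, is within `3.5 k ‖H‖ y` of `H`. The factor `3.5` accounts for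
`‖A k‖ + ‖s‖ ≤ 2 ‖H‖ + 1.5 ‖H‖`. -/
lemma norm_accumUnitary_conj_sub_le {y : ℝ} {s : ℂ} {m : ℕ} (hy : 0 ≤ y)
    (hmy : 3.5 * m * y ≤ 1) (hs : ‖s‖ ≤ 1.5 * ‖A 0‖)
    (hQ : ∀ k, Q k ∈ Matrix.unitaryGroup (Fin n) ℂ)
    (hA : ∀ k, ‖A (k + 1) - (Q k)ᴴ * A k * Q k‖ ≤ (‖A k‖ + ‖s‖) * y) {k : ℕ} (hk : k ≤ m) :
    ‖accumUnitary Q k * A k * (accumUnitary Q k)ᴴ - A 0‖ ≤ 3.5 * k * ‖A 0‖ * y ∧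
      (‖A k‖ + ‖s‖) * y ≤ 3.5 * ‖A 0‖ * y := by
  have second : ∀ k ≤ m,
      ‖accumUnitary Q k * A k * (accumUnitary Q k)ᴴ - A 0‖ ≤ 3.5 * k * ‖A 0‖ * y →
      (‖A k‖ + ‖s‖) * y ≤ 3.5 * ‖A 0‖ * y := by
    intro k hk h
    have h1 : ‖A k‖ ≤ ‖A 0‖ + 3.5 * k * ‖A 0‖ * y := by
      rw [← norm_conj_unitary (accumUnitary_mem hQ k) (A k)]
      linarith [norm_le_norm_add_norm_sub' (accumUnitary Q k * A k * (accumUnitary Q k)ᴴ) (A 0)]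
    have h2 : 3.5 * (k : ℝ) * y ≤ 1 := by
      refine le_trans ?_ hmy
      gcongr
    have h3 : 3.5 * k * ‖A 0‖ * y ≤ ‖A 0‖ := by
      nlinarith [norm_nonneg (A 0)]
    gcongr
    linarith
  induction k with
  | zero =>
    have h : ‖accumUnitary Q 0 * A 0 * (accumUnitary Q 0)ᴴ - A 0‖ ≤
        3.5 * (0 : ℕ) * ‖A 0‖ * y := by
      simp [accumUnitary]
    exact ⟨h, second 0 hk h⟩
  | succ k ih =>
    obtain ⟨h1, h2⟩ := ih (by omega)
    set U := accumUnitary Q k with hU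
    have hUm : U ∈ Matrix.unitaryGroup (Fin n) ℂ := accumUnitary_mem hQ k
    have hQ1 : Q k * (Q k)ᴴ = 1 := Matrix.mem_unitaryGroup_iff.1 (hQ k)
    have key : accumUnitary Q (k + 1) * A (k + 1) * (accumUnitary Q (k + 1))ᴴ - A 0 =
        accumUnitary Q (k + 1) * (A (k + 1) - (Q k)ᴴ * A k * Q k) * (accumUnitary Q (k + 1))ᴴ +
          (U * A k * Uᴴ - A 0) := by
      have : accumUnitary Q (k + 1) * ((Q k)ᴴ * A k * Q k) * (accumUnitary Q (k + 1))ᴴ =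
          U * (Q k * (Q k)ᴴ) * A k * (Q k * (Q k)ᴴ) * Uᴴ := by
        simp only [accumUnitary, Matrix.conjTranspose_mul, ← hU, Matrix.mul_assoc]
      rw [Matrix.mul_sub, Matrix.sub_mul, this, hQ1]
      simp
    have h : ‖accumUnitary Q (k + 1) * A (k + 1) * (accumUnitary Q (k + 1))ᴴ - A 0‖ ≤
        3.5 * (k + 1 : ℕ) * ‖A 0‖ * y := by
      rw [key]
      refine (norm_add_le _ _).trans ?_
      rw [norm_conj_unitary (accumUnitary_mem hQ (k + 1))]
      push_cast
      linarith [hA k]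
    exact ⟨h, second _ hk h⟩

lemma norm_pow_le_of_le {B : Matrix (Fin n) (Fin n) ℂ} {c : ℝ} (hB : ‖B‖ ≤ c) (k : ℕ) :
    ‖B ^ k‖ ≤ c ^ k := by
  induction k with
  | zero =>
    rw [pow_zero, pow_zero, ← Matrix.diagonal_one, Matrix.l2_opNorm_diagonal]
    exact (pi_norm_le_iff_of_nonneg zero_le_one).2 fun _ => by simp
  | succ k ih =>
    have hk : 0 ≤ c ^ k := (norm_nonneg _).trans ih
    rw [pow_succ, pow_succ]
    exact (norm_mul_le _ _).trans (by gcongr)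

/-- Telescoping: if each ratio `P (k + 1) = M k * P k` uses a factor within `g` of `B`, then `P k`
is close to `B ^ k`. The spare factor `c` avoids the exponent `k - 1`. -/
lemma norm_sub_pow_le {B : Matrix (Fin n) (Fin n) ℂ} {M P : ℕ → Matrix (Fin n) (Fin n) ℂ}
    {c g : ℝ} {m : ℕ} (hc : 0 ≤ c) (hB : ‖B‖ ≤ c) (hP0 : P 0 = 1)
    (hP : ∀ k, P (k + 1) = M k * P k) (hMc : ∀ k < m, ‖M k‖ ≤ c)
    (hMB : ∀ k < m, ‖M k - B‖ ≤ g) {k : ℕ} (hk : k ≤ m) :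
    c * ‖P k - B ^ k‖ ≤ k * g * c ^ k := by
  induction k with
  | zero => simp [hP0]
  | succ k ih =>
    have ih := ih (by omega)
    have e : P (k + 1) - B ^ (k + 1) = M k * (P k - B ^ k) + (M k - B) * B ^ k := by
      rw [hP, pow_succ', mul_sub, sub_mul]
      abel
    have hg : 0 ≤ g := (norm_nonneg _).trans (hMB k (by omega))
    have hBk : ‖B ^ k‖ ≤ c ^ k := norm_pow_le_of_le hB k
    have t : ‖P (k + 1) - B ^ (k + 1)‖ ≤ c * ‖P k - B ^ k‖ + g * ‖B ^ k‖ := by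
      rw [e]
      refine (norm_add_le _ _).trans (add_le_add ?_ ?_)
      · exact (norm_mul_le _ _).trans (by gcongr; exact hMc k (by omega))
      · exact (norm_mul_le _ _).trans (by gcongr; exact hMB k (by omega))
    calc c * ‖P (k + 1) - B ^ (k + 1)‖ ≤ c * (c * ‖P k - B ^ k‖ + g * ‖B ^ k‖) := by gcongr
      _ ≤ c * (k * g * c ^ k + g * c ^ k) := by gcongr
      _ = (k + 1 : ℕ) * g * c ^ (k + 1) := by push_cast; ring

end Iteration

/-! ### Shifted diagonalizable matrices -/

section Diagonalizable

variable {n : ℕ} {H V : Matrix (Fin n) (Fin n) ℂ} {lam : Fin n → ℂ} {s : ℂ} {ℓ : Fin n}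

lemma IsDiagonalization.sub_smul_one (h : IsDiagonalization H V lam) (s : ℂ) :
    H - s • (1 : Matrix (Fin n) (Fin n) ℂ) = V * Matrix.diagonal (fun i => lam i - s) * V⁻¹ := by
  have hV : V * V⁻¹ = 1 := Matrix.mul_nonsing_inv V ((Matrix.isUnit_iff_isUnit_det V).1 h.1)
  have e : Matrix.diagonal (fun i => lam i - s) =
      Matrix.diagonal lam - s • (1 : Matrix (Fin n) (Fin n) ℂ) := by
    rw [Matrix.smul_one_eq_diagonal, Matrix.diagonal_sub]
  rw [e, Matrix.mul_sub, Matrix.sub_mul, ← h.2, Matrix.mul_smul, Matrix.mul_one,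
    Matrix.smul_mul, hV]

lemma IsDiagonalization.mem_spectrum (h : IsDiagonalization H V lam) (i : Fin n) :
    lam i ∈ spectrum ℂ H := by
  obtain ⟨U, hU⟩ := h.1
  have e : H = U * Matrix.diagonal lam * (U⁻¹ : (Matrix (Fin n) (Fin n) ℂ)ˣ) := by
    rw [Matrix.coe_units_inv, hU]
    exact h.2
  rw [e, spectrum.units_conjugate, spectrum_diagonal]
  exact Set.mem_range_self i

lemma IsDiagonalization.distSpec_le (h : IsDiagonalization H V lam) (i : Fin n) :
    distSpec s H ≤ ‖lam i - s‖ := by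
  rw [← dist_eq_norm, dist_comm]
  exact Metric.infDist_le_dist_of_mem (h.mem_spectrum i)

/-- The inverse power `(H - s)^(-m)`, written with a diagonalization `H = V diag(λ) V⁻¹`. -/
noncomputable def shiftedInvPow (V : Matrix (Fin n) (Fin n) ℂ) (lam : Fin n → ℂ) (s : ℂ)
    (m : ℕ) : Matrix (Fin n) (Fin n) ℂ :=
  V * Matrix.diagonal (fun i => ((lam i - s) ^ m)⁻¹) * V⁻¹

lemma IsDiagonalization.pow_mul_shiftedInvPow (h : IsDiagonalization H V lam)
    (hs : ∀ i, lam i ≠ s) (m : ℕ) :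
    (H - s • (1 : Matrix (Fin n) (Fin n) ℂ)) ^ m * shiftedInvPow V lam s m = 1 := by
  have hdet := (Matrix.isUnit_iff_isUnit_det V).1 h.1
  have hV : V * V⁻¹ = 1 := Matrix.mul_nonsing_inv V hdet
  have hV' : V⁻¹ * V = 1 := Matrix.nonsing_inv_mul V hdet
  have hpow : (H - s • (1 : Matrix (Fin n) (Fin n) ℂ)) ^ m =
      V * Matrix.diagonal (fun i => (lam i - s) ^ m) * V⁻¹ := by
    induction m with
    | zero => simp [hV]
    | succ m ih =>
      rw [pow_succ, ih, h.sub_smul_one s]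
      calc _ = V * Matrix.diagonal (fun i => (lam i - s) ^ m) * (V⁻¹ * V) *
            Matrix.diagonal (fun i => lam i - s) * V⁻¹ := by simp only [Matrix.mul_assoc]
        _ = _ := by
          rw [hV', Matrix.mul_one, Matrix.mul_assoc V, Matrix.diagonal_mul_diagonal]
          simp only [pow_succ]
  rw [hpow, shiftedInvPow]
  calc _ = V * Matrix.diagonal (fun i => (lam i - s) ^ m) * (V⁻¹ * V) *
        Matrix.diagonal (fun i => ((lam i - s) ^ m)⁻¹) * V⁻¹ := by simp only [Matrix.mul_assoc]
    _ = 1 := by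
      have e : (fun i => (lam i - s) ^ m * ((lam i - s) ^ m)⁻¹) = fun _ => 1 := by
        ext i
        exact mul_inv_cancel₀ (pow_ne_zero m (sub_ne_zero.2 (hs i)))
      rw [hV', Matrix.mul_one, Matrix.mul_assoc V, Matrix.diagonal_mul_diagonal, e,
        Matrix.diagonal_one, Matrix.mul_one, hV]

lemma norm_shiftedInvPow_le {d : ℝ} (hd : 0 < d) (hdi : ∀ i, d ≤ ‖lam i - s‖) (m : ℕ) :
    ‖shiftedInvPow V lam s m‖ ≤ ‖V‖ * ‖V⁻¹‖ / d ^ m := by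
  have h : ‖Matrix.diagonal (fun i => ((lam i - s) ^ m)⁻¹)‖ ≤ (d ^ m)⁻¹ := by
    rw [Matrix.l2_opNorm_diagonal]
    refine (pi_norm_le_iff_of_nonneg (by positivity)).2 fun i => ?_
    rw [norm_inv, norm_pow]
    gcongr
    exact hdi i
  calc ‖shiftedInvPow V lam s m‖ ≤ ‖V‖ * (d ^ m)⁻¹ * ‖V⁻¹‖ :=
        (norm_mul_le _ _).trans (by gcongr; exact (norm_mul_le _ _).trans (by gcongr))
    _ = ‖V‖ * ‖V⁻¹‖ / d ^ m := by ring

lemma one_le_norm_row_mul (h : IsUnit V) : 1 ≤ ‖basisRow ℓ * V‖ * ‖V⁻¹‖ := by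
  have hV : V * V⁻¹ = 1 := Matrix.mul_nonsing_inv V ((Matrix.isUnit_iff_isUnit_det V).1 h)
  have e := Matrix.l2_opNorm_mul (basisRow ℓ * V) V⁻¹
  rwa [Matrix.mul_assoc, hV, Matrix.mul_one, norm_basisRow] at e

variable {hn : 2 ≤ n} {d p : ℝ}

open Classical in
lemma spectralProb_mul_norm_sq (h : IsUnit V) (E : ℂ → Prop) :
    spectralProb hn V lam E * ‖basisRow (⟨n - 1, by omega⟩ : Fin n) * V‖ ^ 2 =
      ∑ i with E (lam i), ‖V ⟨n - 1, by omega⟩ i‖ ^ 2 := by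
  have h1 : 0 < ‖basisRow (⟨n - 1, by omega⟩ : Fin n) * V‖ := by
    by_contra hc
    nlinarith [one_le_norm_row_mul (ℓ := (⟨n - 1, by omega⟩ : Fin n)) h, norm_nonneg V⁻¹]
  have h2 : ‖basisRow (⟨n - 1, by omega⟩ : Fin n) * V‖ ^ 2 =
      ∑ j, ‖V ⟨n - 1, by omega⟩ j‖ ^ 2 := by
    simp only [norm_row_sq, basisRow_mul_apply]
  rw [spectralProb, ← Finset.sum_div, ← h2, div_mul_cancel₀ _ (by positivity)]

lemma spectralProb_le_one (E : ℂ → Prop) : spectralProb hn V lam E ≤ 1 := by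
  classical
  rw [spectralProb, ← Finset.sum_div]
  refine div_le_one_of_le₀ ?_ (by positivity)
  exact Finset.sum_le_sum_of_subset_of_nonneg (Finset.subset_univ _) fun _ _ _ => by positivity

lemma exists_of_spectralProb_pos {E : ℂ → Prop} (h : 0 < spectralProb hn V lam E) :
    ∃ i, E (lam i) := by
  by_contra hc
  push Not at hc
  simp [spectralProb, hc] at h

/-- The weight of `e_n^*` on the eigenvectors nearest to the shift makes the last row of the
inverse power large: its component along these eigenvectors alone has size `√p d^(-m)` relative to
`e_n^* V`. -/
lemma sqrt_spectralProb_le (h : IsUnit V) (hd : 0 < d)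
    (hp : p = spectralProb hn V lam (fun z => ‖z - s‖ = d)) (m : ℕ) :
    √p ≤ ‖basisRow (⟨n - 1, by omega⟩ : Fin n) * shiftedInvPow V lam s m‖ *
      (‖V‖ * ‖V⁻¹‖) * d ^ m := by
  classical
  set ℓ : Fin n := ⟨n - 1, by omega⟩ with hℓ
  have hV' : V⁻¹ * V = 1 := Matrix.nonsing_inv_mul V ((Matrix.isUnit_iff_isUnit_det V).1 h)
  have hrow : p * ‖basisRow ℓ * V‖ ^ 2 ≤
      (‖basisRow ℓ * shiftedInvPow V lam s m * V‖ * d ^ m) ^ 2 := by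
    have e : basisRow ℓ * shiftedInvPow V lam s m * V =
        basisRow ℓ * (V * Matrix.diagonal (fun i => ((lam i - s) ^ m)⁻¹)) := by
      rw [shiftedInvPow, Matrix.mul_assoc, Matrix.mul_assoc _ V⁻¹, hV', Matrix.mul_one]
    rw [hp, spectralProb_mul_norm_sq h, e, mul_pow, norm_row_sq, Finset.sum_mul]
    refine le_trans (Finset.sum_le_sum fun i hi => ?_)
      (Finset.sum_le_sum_of_subset_of_nonneg (Finset.subset_univ _) fun _ _ _ => by positivity)
    rw [Finset.mem_filter] at hi
    rw [basisRow_mul_apply, Matrix.mul_diagonal, norm_mul, norm_inv, norm_pow, hi.2, ← mul_pow,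
      mul_assoc, inv_mul_cancel₀ (by positivity), mul_one]
  have h1 : √p * ‖basisRow ℓ * V‖ ≤ ‖basisRow ℓ * shiftedInvPow V lam s m * V‖ * d ^ m := by
    have := Real.sqrt_le_sqrt hrow
    rwa [Real.sqrt_sq (by positivity), Real.sqrt_mul' _ (by positivity),
      Real.sqrt_sq (by positivity)] at this
  calc √p ≤ √p * (‖basisRow ℓ * V‖ * ‖V⁻¹‖) :=
        le_mul_of_one_le_right (Real.sqrt_nonneg _) (one_le_norm_row_mul h)
    _ ≤ ‖basisRow ℓ * shiftedInvPow V lam s m * V‖ * d ^ m * ‖V⁻¹‖ := by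
        rw [← mul_assoc]
        gcongr
    _ ≤ ‖basisRow ℓ * shiftedInvPow V lam s m‖ * ‖V‖ * d ^ m * ‖V⁻¹‖ := by
        gcongr
        exact Matrix.l2_opNorm_mul _ _
    _ = _ := by ring

/-- If `e_n^*` has no component on the eigenvectors farther from the shift than `d`, the last row
of `H - s` is small. -/
lemma norm_row_sub_le_of_spectralProb_eq_one (h : IsDiagonalization H V lam) (hd : 0 ≤ d)
    (hp : spectralProb hn V lam (fun z => ‖z - s‖ = d) = 1) :
    ‖basisRow (⟨n - 1, by omega⟩ : Fin n) * (H - s • (1 : Matrix (Fin n) (Fin n) ℂ))‖ ≤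
      d * (‖V‖ * ‖V⁻¹‖) := by
  classical
  set ℓ : Fin n := ⟨n - 1, by omega⟩ with hℓ
  have hsum := spectralProb_mul_norm_sq (hn := hn) (lam := lam) h.1 (fun z => ‖z - s‖ = d)
  rw [hp, one_mul, norm_row_sq] at hsum
  simp only [basisRow_mul_apply, ← hℓ] at hsum
  rw [← Finset.sum_filter_add_sum_filter_not Finset.univ (fun i => ‖lam i - s‖ = d)] at hsum
  have hzero : ∑ i with ¬ ‖lam i - s‖ = d, ‖V ℓ i‖ ^ 2 = 0 := by linarith
  rw [Finset.sum_eq_zero_iff_of_nonneg fun _ _ => by positivity] at hzero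
  have hrow : ‖basisRow ℓ * (V * Matrix.diagonal (fun i => lam i - s))‖ =
      d * ‖basisRow ℓ * V‖ := by
    have : ‖basisRow ℓ * (V * Matrix.diagonal (fun i => lam i - s))‖ ^ 2 =
        (d * ‖basisRow ℓ * V‖) ^ 2 := by
      rw [mul_pow, norm_row_sq, norm_row_sq, Finset.mul_sum]
      refine Finset.sum_congr rfl fun i _ => ?_
      rw [basisRow_mul_apply, basisRow_mul_apply, Matrix.mul_diagonal, norm_mul]
      by_cases hi : ‖lam i - s‖ = d
      · rw [hi]
        ring
      · rw [mul_pow, hzero i (by simpa using hi)]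
        ring
    rwa [sq_eq_sq₀ (norm_nonneg _) (by positivity)] at this
  rw [h.sub_smul_one s, ← Matrix.mul_assoc]
  calc _ ≤ ‖basisRow ℓ * (V * Matrix.diagonal (fun i => lam i - s))‖ * ‖V⁻¹‖ :=
        Matrix.l2_opNorm_mul _ _
    _ ≤ d * ‖V‖ * ‖V⁻¹‖ := by
        rw [hrow]
        gcongr
        exact norm_basisRow_mul_le V
    _ = _ := by ring

lemma IsDiagonalization.norm_shift_le (h : IsDiagonalization H V lam)
    (hp : 0 < spectralProb hn V lam (fun z => ‖z - s‖ = d)) : ‖s‖ ≤ ‖H‖ + d := by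
  have : Nonempty (Fin n) := ⟨⟨0, by omega⟩⟩
  obtain ⟨i, hi⟩ := exists_of_spectralProb_pos hp
  have h1 := spectrum.norm_le_norm_of_mem (h.mem_spectrum i)
  have h2 : ‖s‖ ≤ ‖lam i‖ + ‖lam i - s‖ := by
    rw [norm_sub_rev]
    exact norm_le_norm_add_norm_sub' s (lam i)
  rw [hi] at h2
  linarith

lemma IsBalancedDiagonalization.norm_mul_norm_inv (h : IsBalancedDiagonalization H V lam) :
    ‖V‖ * ‖V⁻¹‖ = kappaV H := by
  have h0 : 0 ≤ kappaV H := by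
    refine Real.sInf_nonneg ?_
    rintro c ⟨W, mu, -, rfl⟩
    positivity
  rw [h.2.1, h.2.2, Real.mul_self_sqrt h0]

lemma IsBalancedDiagonalization.one_le_kappaV (h : IsBalancedDiagonalization H V lam)
    (hn : 2 ≤ n) : 1 ≤ kappaV H := by
  rw [← h.norm_mul_norm_inv]
  refine (one_le_norm_row_mul (ℓ := (⟨0, by omega⟩ : Fin n)) h.1.1).trans ?_
  gcongr
  exact norm_basisRow_mul_le V

end Diagonalizable

/-! ### The last row of the iterates -/

section LastRow

variable {n : ℕ} {ℓ : Fin n}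

/-- After a QR step the last row of `A' - s ≈ R Q` is the last row `R ℓ ℓ • e_ℓ^*` of `R`, rotated
by `Q`. -/
lemma norm_entry_le_of_perturbed_step {A A' Q R : Matrix (Fin n) (Fin n) ℂ} {s : ℂ} {ε : ℝ}
    (hℓ : ∀ j, j ≤ ℓ) (hQ : Q ∈ Matrix.unitaryGroup (Fin n) ℂ) (hR : R.BlockTriangular id)
    (hA : ‖A' - Qᴴ * A * Q‖ ≤ ε)
    (hE : ‖A - s • (1 : Matrix (Fin n) (Fin n) ℂ) - Q * R‖ ≤ ε) {j : Fin n} (hj : j ≠ ℓ) :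
    ‖A' ℓ j‖ ≤ ‖R ℓ ℓ‖ + 2 * ε := by
  have : Nonempty (Fin n) := ⟨ℓ⟩
  have hQ' : Qᴴ * Q = 1 := Matrix.mem_unitaryGroup_iff'.1 hQ
  have e : A' - s • (1 : Matrix (Fin n) (Fin n) ℂ) = R * Q +
      (Qᴴ * (A - s • (1 : Matrix (Fin n) (Fin n) ℂ) - Q * R) * Q + (A' - Qᴴ * A * Q)) := by
    have h1 : Qᴴ * (s • (1 : Matrix (Fin n) (Fin n) ℂ)) * Q =
        s • (1 : Matrix (Fin n) (Fin n) ℂ) := by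
      rw [Matrix.mul_smul, Matrix.smul_mul, Matrix.mul_one, hQ']
    have h2 : Qᴴ * (Q * R) * Q = R * Q := by
      rw [← Matrix.mul_assoc, hQ', Matrix.one_mul]
    rw [Matrix.mul_sub, Matrix.mul_sub, Matrix.sub_mul, Matrix.sub_mul, h1, h2]
    abel
  have hentry : A' ℓ j =
      (basisRow ℓ * (A' - s • (1 : Matrix (Fin n) (Fin n) ℂ))) () j := by
    rw [basisRow_mul_apply]
    simp [Matrix.one_apply_ne hj.symm]
  rw [hentry]
  refine (norm_entry_le_norm_row _ j).trans ?_
  rw [e, Matrix.mul_add, ← Matrix.mul_assoc, basisRow_mul_of_blockTriangular hℓ hR]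
  refine (norm_add_le _ _).trans (add_le_add ?_ ?_)
  · rw [Matrix.smul_mul, norm_smul]
    refine mul_le_of_le_one_right (norm_nonneg _) ((norm_basisRow_mul_le Q).trans ?_)
    exact (CStarRing.norm_of_mem_unitary hQ).le
  · refine (norm_basisRow_mul_le _).trans ((norm_add_le _ _).trans ?_)
    rw [norm_conj_unitary' hQ]
    linarith

/-- If `W * T` approximates `B`, with `W` unitary and `e_ℓ^* T = r e_ℓ^*`, then `r` is at most
about the reciprocal of the norm of the last row of `B⁻¹`. -/
lemma norm_mul_norm_row_inv_le {W T B X : Matrix (Fin n) (Fin n) ℂ} {r : ℂ}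
    (hW : W ∈ Matrix.unitaryGroup (Fin n) ℂ) (hT : basisRow ℓ * T = r • basisRow ℓ)
    (hX : B * X = 1) :
    ‖r‖ * ‖basisRow ℓ * X‖ ≤ 1 + ‖W * T - B‖ * ‖X‖ := by
  have : Nonempty (Fin n) := ⟨ℓ⟩
  have hW' : Wᴴ * W = 1 := Matrix.mem_unitaryGroup_iff'.1 hW
  have hW1 : ‖Wᴴ‖ ≤ 1 := by
    rw [Matrix.l2_opNorm_conjTranspose]
    exact (CStarRing.norm_of_mem_unitary hW).le
  have e : r • (basisRow ℓ * X) = basisRow ℓ * (Wᴴ + Wᴴ * ((W * T - B) * X)) := by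
    have h1 : Wᴴ + Wᴴ * ((W * T - B) * X) = T * X := by
      rw [Matrix.sub_mul, hX, Matrix.mul_sub, Matrix.mul_one, Matrix.mul_assoc W,
        ← Matrix.mul_assoc Wᴴ, hW', Matrix.one_mul]
      abel
    rw [h1, ← Matrix.mul_assoc, hT, Matrix.smul_mul]
  rw [← norm_smul, e]
  refine (norm_basisRow_mul_le _).trans ((norm_add_le _ _).trans (add_le_add hW1 ?_))
  refine (norm_mul_le _ _).trans ?_
  calc _ ≤ 1 * ‖(W * T - B) * X‖ := by gcongr
    _ ≤ _ := by
      rw [one_mul]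
      exact norm_mul_le _ _

end LastRow

/-! ### Numerical estimates -/

lemma roundoff_bound {n m : ℕ} {u ν κ d h ω : ℝ} (hn : 2 ≤ n) (hu : 0 ≤ u) (hν : 0 < ν)
    (hκ : 1 ≤ κ) (hh : 0 < h)
    (hr : u ≤ roundoffIQR ν m h κ d * ω / (16 * 5 ^ m * √n * h)) :
    128 * κ * 5 ^ m * h ^ m * (h * (ν * u)) ≤ ω * d ^ m := by
  have hn1 : 1 ≤ √(n : ℝ) := Real.one_le_sqrt.2 (by exact_mod_cast (by omega : 1 ≤ n))
  have e : roundoffIQR ν m h κ d * ω / (16 * 5 ^ m * √n * h) =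
      ω * d ^ m / (8 * κ * ν * h ^ m * (16 * 5 ^ m * √n * h)) := by
    rw [roundoffIQR, div_pow]
    field_simp
  rw [e, le_div_iff₀ (by positivity)] at hr
  refine le_trans ?_ hr
  calc 128 * κ * 5 ^ m * h ^ m * (h * (ν * u)) = 128 * κ * 5 ^ m * h ^ m * (h * (ν * u)) * 1 := by
        ring
    _ ≤ 128 * κ * 5 ^ m * h ^ m * (h * (ν * u)) * √n := by gcongr
    _ = _ := by ring

lemma steps_mul_roundoff_le {m : ℕ} {κ d h ω y : ℝ} (hκ : 1 ≤ κ) (hh : 0 < h) (hd : 0 < d)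
    (hdh : d ≤ h) (hω : 0 < ω) (hy : 0 ≤ y)
    (hr : 128 * κ * 5 ^ m * h ^ m * (h * y) ≤ ω * d ^ m) : m * (h * y) ≤ ω / 128 := by
  have hm : (m : ℝ) ≤ 5 ^ m := by exact_mod_cast (Nat.lt_pow_self (by norm_num)).le
  have hle : d ^ m ≤ h ^ m := by gcongr
  have h1 : 128 * (m * (h * y)) * h ^ m ≤ ω * h ^ m :=
    calc 128 * (m * (h * y)) * h ^ m = 128 * 1 * m * h ^ m * (h * y) := by ring
      _ ≤ 128 * κ * 5 ^ m * h ^ m * (h * y) := by gcongr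
      _ ≤ ω * d ^ m := hr
      _ ≤ ω * h ^ m := by gcongr
  have := le_of_mul_le_mul_right h1 (by positivity)
  linarith

lemma sq_mul_three_pow_le (m : ℕ) : (m : ℝ) ^ 2 * 3 ^ m ≤ 3 * 5 ^ m := by
  have key : ∀ k : ℕ, ((k + 4 : ℕ) : ℝ) ^ 2 * 3 ^ (k + 4) ≤ 3 * 5 ^ (k + 4) := by
    intro k
    induction k with
    | zero => norm_num
    | succ k ih =>
      have h : 3 * ((k + 1 + 4 : ℕ) : ℝ) ^ 2 ≤ 5 * ((k + 4 : ℕ) : ℝ) ^ 2 := by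
        push_cast
        nlinarith [(Nat.cast_nonneg k : (0 : ℝ) ≤ k)]
      calc ((k + 1 + 4 : ℕ) : ℝ) ^ 2 * 3 ^ (k + 1 + 4) =
            3 * ((k + 1 + 4 : ℕ) : ℝ) ^ 2 * 3 ^ (k + 4) := by ring
        _ ≤ 5 * ((k + 4 : ℕ) : ℝ) ^ 2 * 3 ^ (k + 4) := by gcongr
        _ = 5 * (((k + 4 : ℕ) : ℝ) ^ 2 * 3 ^ (k + 4)) := by ring
        _ ≤ 5 * (3 * 5 ^ (k + 4)) := by gcongr
        _ = 3 * 5 ^ (k + 1 + 4) := by ring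
  rcases lt_or_ge m 4 with h | h
  · interval_cases m <;> norm_num
  · obtain ⟨k, rfl⟩ := Nat.exists_eq_add_of_le' h
    exact key k

lemma one_third_le_log {d ω : ℝ} (hd : 0 < d) (hdω : d ≤ ω / 2) :
    1 / 3 ≤ Real.log (3 * ω / (4 * d)) := by
  have h1 : 3 / 2 ≤ 3 * ω / (4 * d) := by
    rw [le_div_iff₀ (by positivity)]
    linarith
  have h2 := Real.one_sub_inv_le_log_of_pos (show (0 : ℝ) < 3 / 2 by norm_num)
  have h3 := Real.log_le_log (by norm_num) h1
  norm_num at h2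
  linarith

/-- The choice of the number of steps: `m` factors `3ω/(4d)` outweigh `κ / √p`. -/
lemma kappa_mul_pow_le {κ p d ω : ℝ} (hκ : 1 ≤ κ) (hp : 0 < p) (hd : 0 < d) (hdω : d ≤ ω / 2) :
    κ * d ^ decoupleSteps κ p d ω ≤ √p * (3 / 4 * ω) ^ decoupleSteps κ p d ω := by
  set m := decoupleSteps κ p d ω with hm
  have hlog := one_third_le_log hd hdω
  have hω : 0 < ω := by linarith
  have hb : 0 < 3 * ω / (4 * d) := by positivity
  have h1 : Real.log (κ ^ 2 / p) / (2 * Real.log (3 * ω / (4 * d))) ≤ m := Nat.le_ceil _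
  rw [div_le_iff₀ (by linarith)] at h1
  have h2 : κ ^ 2 / p ≤ ((3 * ω / (4 * d)) ^ m) ^ 2 := by
    rw [← Real.log_le_log_iff (by positivity) (by positivity), Real.log_pow, Real.log_pow]
    push_cast
    linarith
  rw [div_le_iff₀ hp] at h2
  have h3 : κ ≤ (3 * ω / (4 * d)) ^ m * √p := by
    refine (sq_le_sq₀ (by linarith) (by positivity)).1 ?_
    rw [mul_pow, Real.sq_sqrt hp.le]
    exact h2
  calc κ * d ^ m ≤ (3 * ω / (4 * d)) ^ m * √p * d ^ m := by gcongr
    _ = √p * (3 * ω / (4 * d) * d) ^ m := by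
      rw [mul_pow]
      ring
    _ = √p * (3 / 4 * ω) ^ m := by
      congr 2
      field_simp

/-- The perturbation of the `m`-th power, relative to the size `d ^ m / κ` of `(H - s)^m` on the
nearest eigenvectors. -/
lemma perturbation_ratio_le {m : ℕ} {κ d h ω y Δ : ℝ} (hκ : 1 ≤ κ) (hd : 0 < d) (hω : 0 < ω)
    (hωh : ω < h) (hy : 0 ≤ y)
    (hr : 128 * κ * 5 ^ m * h ^ m * (h * y) ≤ ω * d ^ m)
    (hΔ : 3 * h * Δ ≤ m * (3.5 * m * h * y) * (3 * h) ^ m) : Δ * (κ / d ^ m) ≤ 1 / 8 := by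
  have hh : 0 < h := hω.trans hωh
  have h1 : 3 * h * Δ ≤ 3.5 * (3 * 5 ^ m) * h ^ m * (h * y) := by
    refine hΔ.trans ?_
    calc m * (3.5 * m * h * y) * (3 * h) ^ m = 3.5 * (m ^ 2 * 3 ^ m) * h ^ m * (h * y) := by
          rw [mul_pow]
          ring
      _ ≤ _ := by
          have := sq_mul_three_pow_le m
          gcongr ?_ * _ * _
          exact mul_le_mul_of_nonneg_left this (by norm_num)
  have h2 : h * (Δ * κ) ≤ h * (1 / 8 * d ^ m) := by
    have e : 128 * (h * (Δ * κ)) ≤ 3.5 * (ω * d ^ m) :=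
      calc 128 * (h * (Δ * κ)) = 128 / 3 * (3 * h * Δ) * κ := by ring
        _ ≤ 128 / 3 * (3.5 * (3 * 5 ^ m) * h ^ m * (h * y)) * κ := by gcongr
        _ = 3.5 * (128 * κ * 5 ^ m * h ^ m * (h * y)) := by ring
        _ ≤ _ := by gcongr
    have e2 : ω * d ^ m ≤ h * d ^ m := by gcongr
    have : 0 < h * d ^ m := by positivity
    linarith
  have h3 := le_of_mul_le_mul_left h2 hh
  rw [← mul_div_assoc, div_le_iff₀ (by positivity)]
  exact h3

/-- `m` diagonal entries of size `15 ω / 16` are incompatible with their product being close to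
the reciprocal of the last row of `(H - s)^(-m)`. -/
lemma false_of_product_bounds {m : ℕ} {κ d ω p r N : ℝ} (hm : m ≠ 0) (hd : 0 < d)
    (hω : 0 < ω) (hp : 0 < p) (hκ : 1 ≤ κ) (hsteps : κ * d ^ m ≤ √p * (3 / 4 * ω) ^ m)
    (hN : √p ≤ N * κ * d ^ m) (hrN : r * N ≤ 9 / 8) (hr : (15 / 16 * ω) ^ m ≤ r) : False := by
  have hsp : 0 < √p := Real.sqrt_pos.2 hp
  have hr0 : 0 ≤ r := le_trans (by positivity) hr
  have hN0 : 0 ≤ N * κ * d ^ m := hsp.le.trans hN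
  have h1 : √p * (15 / 16 * ω) ^ m ≤ √p * (9 / 8 * (3 / 4 * ω) ^ m) :=
    calc √p * (15 / 16 * ω) ^ m ≤ N * κ * d ^ m * r := by gcongr
      _ = r * N * (κ * d ^ m) := by ring
      _ ≤ 9 / 8 * (√p * (3 / 4 * ω) ^ m) := by gcongr
      _ = _ := by ring
  have h2 := le_of_mul_le_mul_left h1 hsp
  have h3 : (15 / 16 * ω) ^ m = (5 / 4) ^ m * (3 / 4 * ω) ^ m := by
    rw [← mul_pow]
    congr 1
    ring
  rw [h3] at h2
  have h4 := le_of_mul_le_mul_right h2 (by positivity)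
  have h5 : (5 / 4 : ℝ) ≤ (5 / 4) ^ m := le_self_pow₀ (by norm_num) hm
  linarith

lemma log_kappa_div_nonneg {κ p : ℝ} (hκ : 1 ≤ κ) (hp : 0 < p) (hp1 : p ≤ 1) :
    0 ≤ Real.log (κ / p) :=
  Real.log_nonneg ((one_le_div hp).2 (hp1.trans hκ))

lemma decoupleSteps_le {κ p d ω : ℝ} (hκ : 1 ≤ κ) (hp : 0 < p) (hp1 : p ≤ 1) (hd : 0 < d)
    (hdω : d ≤ ω / 2) : (decoupleSteps κ p d ω : ℝ) ≤ 3 * Real.log (κ / p) + 1 := by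
  have hlog := one_third_le_log hd hdω
  have h0 := log_kappa_div_nonneg hκ hp hp1
  have hκ0 : 0 < κ := by linarith
  have h1 : Real.log (κ ^ 2 / p) ≤ 2 * Real.log (κ / p) := by
    rw [Real.log_div (by positivity) hp.ne', Real.log_div hκ0.ne' hp.ne', Real.log_pow]
    push_cast
    linarith [Real.log_nonpos hp.le hp1]
  have h2 : Real.log (κ ^ 2 / p) / (2 * Real.log (3 * ω / (4 * d))) ≤ 3 * Real.log (κ / p) := by
    rw [div_le_iff₀ (by linarith)]
    nlinarith
  have h3 : (decoupleSteps κ p d ω : ℝ) ≤ ⌈3 * Real.log (κ / p)⌉₊ := by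
    exact_mod_cast Nat.ceil_le_ceil h2
  exact h3.trans (Nat.ceil_lt_add_one (by positivity)).le

/-- If no step is needed, `H` is normal and `e_n^*` is supported on the nearest eigenvectors. -/
lemma eq_one_of_decoupleSteps_eq_zero {κ p d ω : ℝ} (hκ : 1 ≤ κ) (hp : 0 < p) (hp1 : p ≤ 1)
    (hd : 0 < d) (hdω : d ≤ ω / 2) (hm : decoupleSteps κ p d ω = 0) : κ = 1 ∧ p = 1 := by
  have h := kappa_mul_pow_le hκ hp hd hdω
  rw [hm, pow_zero, pow_zero, mul_one, mul_one] at h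
  have h1 : √p ≤ 1 := Real.sqrt_le_one.2 hp1
  have hκ1 : κ = 1 := by linarith
  have h2 : √p = 1 := by linarith
  exact ⟨hκ1, Real.sqrt_eq_one.1 h2⟩

lemma ops_le_of_steps_le {n : ℕ} {m L ops : ℝ} (hn : 2 ≤ n) (hm0 : 0 ≤ m) (hL : 0 ≤ L)
    (hm : m ≤ 3 * L + 1) (hops : ops ≤ 7 * m ^ 2 * n ^ 2 + (m + 1)) :
    ops ≤ 594 * (1 + L) ^ 2 * n ^ 2 ∧ (1 / 2 ≤ L → ops ≤ 594 * L ^ 2 * n ^ 2) := by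
  have hn1 : (1 : ℝ) ≤ (n : ℝ) ^ 2 := one_le_pow₀ (by exact_mod_cast (by omega : 1 ≤ n))
  have h1 : ops ≤ 66 * (1 + L) ^ 2 * n ^ 2 := by
    have h2 : m ^ 2 ≤ 9 * (1 + L) ^ 2 := by nlinarith
    have h3 : m + 1 ≤ 3 * (1 + L) ^ 2 * 1 := by nlinarith
    have h4 : 3 * (1 + L) ^ 2 * 1 ≤ 3 * (1 + L) ^ 2 * (n : ℝ) ^ 2 := by gcongr
    have h5 : 7 * m ^ 2 * (n : ℝ) ^ 2 ≤ 7 * (9 * (1 + L) ^ 2) * (n : ℝ) ^ 2 := by gcongr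
    linarith
  refine ⟨h1.trans (by gcongr; norm_num), fun hL2 => h1.trans ?_⟩
  have : (1 + L) ^ 2 ≤ (3 * L) ^ 2 := by gcongr; linarith
  calc 66 * (1 + L) ^ 2 * (n : ℝ) ^ 2 ≤ 66 * (3 * L) ^ 2 * (n : ℝ) ^ 2 := by gcongr
    _ = _ := by ring

/-! ### Termination and cost of the loop -/

section Decouple

variable {u : ℝ} {n : ℕ} {F : FloatArith u} {P : IQRProgram n} {ν : ℝ}
  {H V : Matrix (Fin n) (Fin n) ℂ} {lam : Fin n → ℂ} {s : ℂ} {ω d p : ℝ}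

lemma isHessenberg_decoupleIter (hP : P.IsStable F ν) (hH : IsHessenberg H) (k : ℕ) :
    IsHessenberg (decoupleIter F P H s k) := by
  induction k with
  | zero => exact hH
  | succ k ih => exact (hP _ s ih).1

lemma decoupleIQROps_le (hP : P.IsStable F ν)
    (hcost : ∀ (A : Matrix (Fin n) (Fin n) ℂ) (z : ℂ), IsHessenberg A →
      P.cost F A z ≤ opsIQR n 1) (hH : IsHessenberg H) {k m : ℕ} (hk : k ≤ m) :
    decoupleIQROps F P H s k ≤ m * opsIQR n m := by
  have h1 : decoupleIQROps F P H s k ≤ k * opsIQR n 1 := by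
    refine (Finset.sum_le_card_nsmul _ _ (opsIQR n 1) fun j _ =>
      hcost _ s (isHessenberg_decoupleIter hP hH j)).trans ?_
    simp
  refine h1.trans ?_
  rcases Nat.eq_zero_or_pos m with rfl | hm
  · simp [Nat.le_zero.1 hk]
  · exact Nat.mul_le_mul hk (by unfold opsIQR; gcongr; omega)

lemma norm_lastSubdiag_le_norm_row (hn : 2 ≤ n) :
    ‖lastSubdiag hn H‖ ≤
      ‖basisRow (⟨n - 1, by omega⟩ : Fin n) * (H - s • (1 : Matrix (Fin n) (Fin n) ℂ))‖ := by
  refine le_trans (le_of_eq ?_) (norm_entry_le_norm_row _ (⟨n - 2, by omega⟩ : Fin n))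
  rw [basisRow_mul_apply, lastSubdiag]
  have : (⟨n - 1, by omega⟩ : Fin n) ≠ ⟨n - 2, by omega⟩ := by
    rw [Ne, Fin.mk.injEq]
    omega
  simp [Matrix.one_apply_ne this]

lemma norm_lastSubdiag_le (hn : 2 ≤ n) : ‖lastSubdiag hn H‖ ≤ ‖H‖ := by
  have h := norm_lastSubdiag_le_norm_row (H := H) (s := 0) hn
  rw [zero_smul, sub_zero] at h
  exact h.trans (norm_basisRow_mul_le H)

/-- Termination when `ω < ‖H‖` and at least one step is allowed: some iterate `1 ≤ k ≤ m` is
decoupled, and all iterates up to `m` are backward stable. -/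
lemma exists_decoupled_of_lt (hn : 2 ≤ n) (hu : 0 ≤ u) (hν : 0 < ν) (hP : P.IsStable F ν)
    (hH : IsHessenberg H) (hV : IsBalancedDiagonalization H V lam) (hωH : ω < ‖H‖)
    (hd : d = distSpec s H) (hd0 : 0 < d) (hdω : d ≤ ω / 2)
    (hp : p = spectralProb hn V lam (fun z => ‖z - s‖ = d)) (hp0 : 0 < p)
    (hm0 : decoupleSteps (kappaV H) p d ω ≠ 0)
    (hr : u ≤ roundoffDecouple n ν ‖H‖ (kappaV H) p d ω) :
    (∃ k ≤ decoupleSteps (kappaV H) p d ω, ‖lastSubdiag hn (decoupleIter F P H s k)‖ ≤ ω) ∧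
      ∀ k ≤ decoupleSteps (kappaV H) p d ω, ∃ Q ∈ Matrix.unitaryGroup (Fin n) ℂ,
        ‖decoupleIter F P H s k - Qᴴ * H * Q‖ ≤ 3.5 * k * ‖H‖ * (ν * u) := by
  set κ := kappaV H with hκdef
  set m := decoupleSteps κ p d ω with hm
  set ℓ : Fin n := ⟨n - 1, by omega⟩ with hℓdef
  have hℓ : ∀ j : Fin n, j ≤ ℓ := fun j => by
    rw [Fin.le_def]
    have := j.2
    simp only [hℓdef]
    omega
  have hκ : 1 ≤ κ := hV.one_le_kappaV hn
  have hω : 0 < ω := by linarith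
  have hh : 0 < ‖H‖ := hω.trans hωH
  have hy : 0 ≤ ν * u := by positivity
  have hround := roundoff_bound hn hu hν hκ hh hr
  rw [← hm] at hround
  have hmy := steps_mul_roundoff_le hκ hh hd0 (by linarith) hω hy hround
  have hm1 : (1 : ℝ) ≤ m := by exact_mod_cast Nat.one_le_iff_ne_zero.2 hm0
  have hhy : ‖H‖ * (ν * u) ≤ ω / 128 :=
    (le_mul_of_one_le_left (by positivity) hm1).trans hmy
  have hs : ‖s‖ ≤ 1.5 * ‖H‖ := by
    have := hV.1.norm_shift_le (hp ▸ hp0)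
    linarith
  set A := decoupleIter F P H s with hA
  have hA0 : A 0 = H := rfl
  set R := fun k => P.factor F (A k) s with hRdef
  have hHk : ∀ k, IsHessenberg (A k) := isHessenberg_decoupleIter hP hH
  have hR : ∀ k, (R k).BlockTriangular id := fun k => (hP (A k) s (hHk k)).2.1
  choose Q hQ hQA hQR using fun k => (hP (A k) s (hHk k)).2.2
  simp only [mul_assoc] at hQA hQR
  have hQA' : ∀ k, ‖A (k + 1) - (Q k)ᴴ * A k * Q k‖ ≤ (‖A k‖ + ‖s‖) * (ν * u) := fun k => by
    rw [Matrix.mul_assoc]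
    exact hQA k
  have hmy1 : 3.5 * (m : ℝ) * (ν * u) ≤ 1 := by
    refine le_of_mul_le_mul_left ?_ hh
    linarith
  have hback := fun k (hk : k ≤ m) =>
    norm_accumUnitary_conj_sub_le (A := A) (Q := Q) (s := s) hy hmy1 hs hQ hQA' hk
  rw [hA0] at hback
  refine ⟨?_, fun k hk => ⟨accumUnitary Q k, accumUnitary_mem hQ k, ?_⟩⟩
  · by_contra! hcon
    have hUm := accumUnitary_mem hQ
    have hdi : ∀ i, d ≤ ‖lam i - s‖ := fun i => hd ▸ hV.1.distSpec_le i
    have hne : ∀ i, lam i ≠ s := fun i hi => by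
      have := hdi i
      rw [hi, sub_self, norm_zero] at this
      linarith
    set B := H - s • (1 : Matrix (Fin n) (Fin n) ℂ) with hB
    have hBnorm : ‖B‖ ≤ 2.5 * ‖H‖ := by
      have : Nonempty (Fin n) := ⟨ℓ⟩
      have h1 : ‖s • (1 : Matrix (Fin n) (Fin n) ℂ)‖ = ‖s‖ := by
        rw [norm_smul, CStarRing.norm_one, mul_one]
      have h2 := norm_sub_le H (s • (1 : Matrix (Fin n) (Fin n) ℂ))
      rw [h1] at h2
      linarith
    set U := accumUnitary Q with hU
    -- `U k * T k`, with `T k` the accumulated triangular factor, is the product of the matrices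
    -- `M j`, `j < k`, each of which is a perturbation of `B = H - s`
    set M := fun k => U (k + 1) * R k * (U k)ᴴ with hM
    have hMB : ∀ k < m, ‖M k - B‖ ≤ 3.5 * m * ‖H‖ * (ν * u) := by
      intro k hk
      obtain ⟨h1, h2⟩ := hback k hk.le
      have hUU : U k * (U k)ᴴ = 1 := Matrix.mem_unitaryGroup_iff.1 (hUm k)
      have e : M k - B = (U k * A k * (U k)ᴴ - H) -
          U k * (A k - s • (1 : Matrix (Fin n) (Fin n) ℂ) - Q k * R k) * (U k)ᴴ := by
        have e1 : U k * (s • (1 : Matrix (Fin n) (Fin n) ℂ)) * (U k)ᴴ =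
            s • (1 : Matrix (Fin n) (Fin n) ℂ) := by
          rw [Matrix.mul_smul, Matrix.smul_mul, Matrix.mul_one, hUU]
        have e2 : M k = U k * (Q k * R k) * (U k)ᴴ := by
          rw [← Matrix.mul_assoc (U k)]
          rfl
        rw [Matrix.mul_sub, Matrix.mul_sub, Matrix.sub_mul, Matrix.sub_mul, e1, ← e2, hB]
        abel
      rw [e]
      refine (norm_sub_le _ _).trans ?_
      rw [norm_conj_unitary (hUm k)]
      have h3 := (hQR k).trans h2
      have h4 : (k : ℝ) + 1 ≤ m := by exact_mod_cast hk
      calc _ ≤ 3.5 * k * ‖H‖ * (ν * u) + 3.5 * ‖H‖ * (ν * u) := add_le_add h1 h3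
        _ = 3.5 * (k + 1) * ‖H‖ * (ν * u) := by ring
        _ ≤ _ := by gcongr
    have hMc : ∀ k < m, ‖M k‖ ≤ 3 * ‖H‖ := by
      intro k hk
      have h1 := norm_le_norm_add_norm_sub' (M k) B
      linarith [hMB k hk]
    have hΔ := norm_sub_pow_le (P := fun k => U k * accumTriangular R k) (by positivity)
      (show ‖B‖ ≤ 3 * ‖H‖ by linarith) (by simp [hU, accumUnitary, accumTriangular])
      (fun k => by
        have hUU : (U k)ᴴ * U k = 1 := Matrix.mem_unitaryGroup_iff'.1 (hUm k)
        calc U (k + 1) * (R k * accumTriangular R k) =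
              U (k + 1) * R k * ((U k)ᴴ * U k) * accumTriangular R k := by
              rw [hUU, Matrix.mul_one, Matrix.mul_assoc]
          _ = _ := by simp only [hM, Matrix.mul_assoc])
      hMc hMB le_rfl
    have hinv := norm_mul_norm_row_inv_le (hUm m) (basisRow_mul_accumTriangular hℓ hR m)
      (hV.1.pow_mul_shiftedInvPow hne m)
    have hX := norm_shiftedInvPow_le (V := V) hd0 hdi m
    rw [hV.norm_mul_norm_inv] at hX
    have hN := sqrt_spectralProb_le hV.1.1 hd0 hp m
    rw [hV.norm_mul_norm_inv] at hN
    refine false_of_product_bounds hm0 hd0 hω hp0 hκ (kappa_mul_pow_le hκ hp0 hd0 hdω) hN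
      (r := ‖∏ j ∈ Finset.range m, R j ℓ ℓ‖) ?_ ?_
    · refine hinv.trans ?_
      have h1 := perturbation_ratio_le hκ hd0 hω hωH hy hround hΔ
      have h2 : ‖U m * accumTriangular R m - B ^ m‖ * ‖shiftedInvPow V lam s m‖ ≤
          ‖U m * accumTriangular R m - B ^ m‖ * (κ / d ^ m) := by gcongr
      linarith
    · rw [norm_prod, ← Finset.card_range m, ← Finset.prod_const, Finset.card_range]
      refine Finset.prod_le_prod (fun _ _ => by positivity) fun j hj => ?_
      have hj' : j < m := Finset.mem_range.1 hj
      have h1 := (hback j hj'.le).2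
      have h2 : ‖lastSubdiag hn (A (j + 1))‖ ≤ ‖R j ℓ ℓ‖ + 2 * ((‖A j‖ + ‖s‖) * (ν * u)) :=
        norm_entry_le_of_perturbed_step hℓ (hQ j) (hR j) (hQA' j) (hQR j) (by
          rw [hℓdef, Ne, Fin.mk.injEq]
          omega)
      -- the two errors of the step add up to at most `7 ω / 128 ≤ ω / 16`
      linarith [hcon (j + 1) hj']
  · rw [← norm_conj_unitary (accumUnitary_mem hQ k)]
    have hUU : accumUnitary Q k * (accumUnitary Q k)ᴴ = 1 :=
      Matrix.mem_unitaryGroup_iff.1 (accumUnitary_mem hQ k)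
    refine le_trans (le_of_eq ?_) (hback k hk).1
    rw [Matrix.mul_sub, Matrix.sub_mul]
    congr 2
    calc _ = (accumUnitary Q k * (accumUnitary Q k)ᴴ) * H *
          (accumUnitary Q k * (accumUnitary Q k)ᴴ) := by simp only [Matrix.mul_assoc]
      _ = H := by rw [hUU, Matrix.one_mul, Matrix.mul_one]

lemma exists_decoupleHaltsAfter (hn : 2 ≤ n) (hu : 0 ≤ u) (hν : 0 < ν) (hP : P.IsStable F ν)
    (hH : IsHessenberg H) (hV : IsBalancedDiagonalization H V lam)
    (hd : d = distSpec s H) (hd0 : 0 < d) (hdω : d ≤ ω / 2)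
    (hp : p = spectralProb hn V lam (fun z => ‖z - s‖ = d)) (hp0 : 0 < p)
    (hr : u ≤ roundoffDecouple n ν ‖H‖ (kappaV H) p d ω) :
    ∃ k ≤ decoupleSteps (kappaV H) p d ω, DecoupleHaltsAfter hn F P H s ω k ∧
      ∃ Q ∈ Matrix.unitaryGroup (Fin n) ℂ,
        ‖decoupleIter F P H s k - Qᴴ * H * Q‖ ≤ 3.5 * k * ‖H‖ * (ν * u) := by
  -- a large `ω`, in particular `ω ≥ ‖H‖`, needs no step; the round-off bounds require `ω < ‖H‖`
  by_cases h0 : ‖lastSubdiag hn H‖ ≤ ω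
  · refine ⟨0, Nat.zero_le _, ⟨by simp, h0⟩, 1, one_mem _, ?_⟩
    simp [decoupleIter]
  have hωH : ω < ‖H‖ := (not_le.1 h0).trans_le (norm_lastSubdiag_le hn)
  have hκ : 1 ≤ kappaV H := hV.one_le_kappaV hn
  have hm0 : decoupleSteps (kappaV H) p d ω ≠ 0 := by
    intro hm
    obtain ⟨h1, h2⟩ := eq_one_of_decoupleSteps_eq_zero hκ hp0 (hp ▸ spectralProb_le_one _) hd0
      hdω hm
    have h3 := norm_row_sub_le_of_spectralProb_eq_one hV.1 hd0.le (hp.symm.trans h2)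
    rw [hV.norm_mul_norm_inv, h1, mul_one] at h3
    exact h0 ((norm_lastSubdiag_le_norm_row hn).trans (by linarith))
  classical
  obtain ⟨hex, hback⟩ :=
    exists_decoupled_of_lt hn hu hν hP hH hV hωH hd hd0 hdω hp hp0 hm0 hr
  obtain ⟨k, hkm, hk⟩ := hex
  have hex' : ∃ k, ‖lastSubdiag hn (decoupleIter F P H s k)‖ ≤ ω := ⟨k, hk⟩
  have hle : Nat.find hex' ≤ decoupleSteps (kappaV H) p d ω := (Nat.find_min' hex' hk).trans hkm
  exact ⟨Nat.find hex', hle, ⟨fun j hj => not_le.1 (Nat.find_min hex' hj), Nat.find_spec hex'⟩,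
    hback _ hle⟩

end Decouple

theorem mainTheorem8 :
    ∃ C : ℝ, 0 < C ∧
      ∀ (n : ℕ) (hn : 2 ≤ n) (u : ℝ) (_ : 0 ≤ u) (F : FloatArith u)
        (ν : ℕ → ℝ) (_ : 0 < ν n) (IQR : (k : ℕ) → IQRProgram k)
        (_ : (IQR n).IsStable F (ν n))
        (_ : ∀ (A : Matrix (Fin n) (Fin n) ℂ) (z : ℂ), IsHessenberg A →
          (IQR n).cost F A z ≤ opsIQR n 1)
        (H V : Matrix (Fin n) (Fin n) ℂ) (lam : Fin n → ℂ)
        (_ : IsHessenberg H) (_ : IsBalancedDiagonalization H V lam)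
        (s : ℂ) (ω d p : ℝ) (m : ℕ)
        (_ : 0 < ω)
        (_ : d = distSpec s H) (_ : 0 < d) (_ : d ≤ ω / 2)
        (_ : p = spectralProb hn V lam (fun z => ‖z - s‖ = d)) (_ : 0 < p)
        (_ : m = decoupleSteps (kappaV H) p d ω)
        (_ : u ≤ roundoffDecouple n (ν n) ‖H‖ (kappaV H) p d ω),
        (∃ k : ℕ, k ≤ m ∧ DecoupleHaltsAfter hn F (IQR n) H s ω k ∧
          IsHessenberg (decoupleIter F (IQR n) H s k) ∧
          ‖lastSubdiag hn (decoupleIter F (IQR n) H s k)‖ ≤ ω ∧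
          (∃ Q ∈ Matrix.unitaryGroup (Fin n) ℂ,
            ‖decoupleIter F (IQR n) H s k - Qᴴ * H * Q‖ ≤ 3.5 * m * ‖H‖ * ν n * u) ∧
          decoupleIQROps F (IQR n) H s k ≤ m * opsIQR n m ∧
          decoupleOps F (IQR n) H s k ≤ m * opsIQR n m + (m + 1) ∧
          (decoupleOps F (IQR n) H s k : ℝ)
            ≤ C * (1 + Real.log (kappaV H / p)) ^ 2 * (n : ℝ) ^ 2 ∧
          (2 ≤ kappaV H / p →
            (decoupleOps F (IQR n) H s k : ℝ)
              ≤ C * Real.log (kappaV H / p) ^ 2 * (n : ℝ) ^ 2)) ∧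
        ((m * opsIQR n m : ℕ) : ℝ) ≤ C * (1 + Real.log (kappaV H / p)) ^ 2 * (n : ℝ) ^ 2 ∧
        (2 ≤ kappaV H / p →
          ((m * opsIQR n m : ℕ) : ℝ) ≤ C * Real.log (kappaV H / p) ^ 2 * (n : ℝ) ^ 2) := by

  -- `7 m ^ 2 n ^ 2 + m + 1 ≤ 66 (1 + L) ^ 2 n ^ 2` with `L = log (κ / p)`, and `1 + L ≤ 3 L` if
  -- `κ / p ≥ 2`, whence the constant `594 = 9 * 66`
  refine ⟨594, by norm_num, ?_⟩
  intro n hn u hu F ν hν IQR hP hcost H V lam hH hV s ω d p m _ hd hd0 hdω hp hp0 hm hr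
  have hκ : 1 ≤ kappaV H := hV.one_le_kappaV hn
  have hp1 : p ≤ 1 := hp ▸ spectralProb_le_one _
  have hL := log_kappa_div_nonneg hκ hp0 hp1
  have hmL : (m : ℝ) ≤ 3 * Real.log (kappaV H / p) + 1 :=
    hm ▸ decoupleSteps_le hκ hp0 hp1 hd0 hdω
  have hL2 : 2 ≤ kappaV H / p → 1 / 2 ≤ Real.log (kappaV H / p) := fun h =>
    le_trans (by linarith [Real.log_two_gt_d9]) (Real.log_le_log two_pos h)
  have hops : ∀ a : ℕ, a ≤ m * opsIQR n m + (m + 1) →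
      (a : ℝ) ≤ 594 * (1 + Real.log (kappaV H / p)) ^ 2 * (n : ℝ) ^ 2 ∧
        (2 ≤ kappaV H / p → (a : ℝ) ≤ 594 * Real.log (kappaV H / p) ^ 2 * (n : ℝ) ^ 2) := by
    intro a ha
    have ha' : (a : ℝ) ≤ 7 * (m : ℝ) ^ 2 * n ^ 2 + (m + 1) := by
      refine (Nat.cast_le.2 ha).trans (le_of_eq ?_)
      simp only [opsIQR]
      push_cast
      ring
    obtain ⟨h1, h2⟩ := ops_le_of_steps_le hn m.cast_nonneg hL hmL ha'
    exact ⟨h1, fun h => h2 (hL2 h)⟩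
  obtain ⟨k, hk, hhalt, Q, hQ, hQk⟩ :=
    exists_decoupleHaltsAfter hn hu hν hP hH hV hd hd0 hdω hp hp0 hr
  rw [← hm] at hk
  have hiqr := decoupleIQROps_le (s := s) hP hcost hH hk
  have htotal : decoupleOps F (IQR n) H s k ≤ m * opsIQR n m + (m + 1) := by
    unfold decoupleOps
    omega
  have h1 := hops _ htotal
  have h2 := hops (m * opsIQR n m) (Nat.le_add_right _ _)
  refine ⟨⟨k, hk, hhalt, isHessenberg_decoupleIter hP hH k, hhalt.2, ⟨Q, hQ, hQk.trans ?_⟩, hiqr,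
    htotal, h1.1, h1.2⟩, h2.1, h2.2⟩
  rw [← mul_assoc]
  have := hν.le
  gcongr
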